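/- Work in the category $\mathbf{Meas}$ of measurable spaces and measurable functions, and use the following monads on it. * $G$ is the Giry monad. $GX$ is the set of probability measures on $X$ with the $\sigma$-algebra generated by the evaluations $\nu\mapsto\nu(U)$, $U\subseteq X$ measurable; $Gf$ is push-forward along $f$; $\eta^G(x)=\delta_x$; $\mu^G(\nu)(U)=\int_{GX}\xi(U)\,d\nu(\xi)$. * $M$ is the monad of all measures. $MX$ is the set of all measures $\Sigma_X\to[0,\infty]$, with the $\sigma$-algebra, functorial action, unit and multiplication given by the same formulas. * $B$ is the bag monad. $BX$ is the set of finite multisets of elements of $X$ with the $\sigma$-algebra generated by the sets $A^U_k=\{b\in BX : b \text{ contains exactly } k \text{ elements in } U, \text{ counted with multiplicity}\}$ for $U\subseteq X$ measurable and $k\in\mathbb N$; $Bf$ applies $f$ to each element; $\eta^B(x)=[x]$; $\mu^B$ is the multiplicity-respecting union. The distributive law $l:BG\to GB$ sends $[\nu_1,\dots,\nu_n]$ to the push-forward of the product measure $\nu_1\otimes\dots\otimes\nu_n$ along $X^n\to BX$, $(x_1,\dots,x_n)\mapsto[x_1,\dots,x_n]$. It induces the point-process monad $GB$, with unit $\eta^G\ast\eta^B$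 and multiplication $(\mu^G\ast\mu^B)\circ GlB$. Let $i^G:G\to M$ be the inclusion, let $i^B:B\to M$ be given by $[x_1,\dots,x_n]\mapsto\sum_{i=1}^n\delta_{x_i}$, and put $$\mathbb E \;:=\; \bigl(GB\xrightarrow{\;i^G\ast i^B\;}MM\xrightarrow{\;\mu^M\;}M\bigr).$$ **Theorem.** $\mathbb E$ is a monad morphism from $GB$ to $M$: it is a natural transformation with $$\mathbb E\circ\eta^{GB}=\eta^M\qquad\text{and}\qquad \mathbb E\circ\mu^{GB}=\mu^M\circ(\mathbb E\ast\mathbb E).$$ Moreover, for every measurable space $X$, every point process $\alpha\in GBX$ and every measurable $U\subseteq X$, $$\mathbb E_X(\alpha)(U)=\sum_{k\in\mathbb N}k\cdot\alpha(A^U_k)\in[0,\infty],$$ i.e. $\mathbb E_X(\alpha)$ is the intensity measure of $\alpha$. -/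

import Mathlib

open CategoryTheory MeasureTheory
open scoped ENNReal
universe u v w

namespace PointProcess

/-! ### Distributive laws and composite monads -/

/-- A distributive law `l : S T → T S` (as composites of functors, `T` applied first) of the monad
`T` over the monad `S` in the sense of Beck. -/
structure DistribLaw {C : Type u} [Category.{v} C] (S T : Monad C) where
  law : T.toFunctor ⋙ S.toFunctor ⟶ S.toFunctor ⋙ T.toFunctor
  triangle_left : ∀ X : C, S.map (T.η.app X) ≫ law.app X = T.η.app (S.obj X)
  triangle_right : ∀ X : C, S.η.app (T.obj X) ≫ law.app X = T.map (S.η.app X)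
  pentagon_left : ∀ X : C, S.map (T.μ.app X) ≫ law.app X =
    law.app (T.obj X) ≫ T.map (law.app X) ≫ T.μ.app (S.obj X)
  pentagon_right : ∀ X : C, S.μ.app (T.obj X) ≫ law.app X =
    S.map (law.app X) ≫ law.app (S.obj X) ≫ T.map (S.μ.app X)

/-- The multiplication `TSTS → TTSS → TS`, i.e. `T l S` followed by `μ^T ∗ μ^S`. -/
def DistribLaw.mul {C : Type u} [Category.{v} C] {S T : Monad C} (l : DistribLaw S T) :
    (S.toFunctor ⋙ T.toFunctor) ⋙ (S.toFunctor ⋙ T.toFunctor) ⟶ S.toFunctor ⋙ T.toFunctor :=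
  Functor.whiskerRight (Functor.whiskerLeft S.toFunctor l.law) T.toFunctor ≫
    (show (S.toFunctor ⋙ S.toFunctor) ⋙ (T.toFunctor ⋙ T.toFunctor) ⟶ _ from S.μ ◫ T.μ)

lemma DistribLaw.mul_app {C : Type u} [Category.{v} C] {S T : Monad C} (l : DistribLaw S T)
    (X : C) : l.mul.app X = T.map (l.law.app (S.obj X)) ≫ T.μ.app (S.obj (S.obj X)) ≫
      T.map (S.μ.app X) := by
  simp [DistribLaw.mul]

lemma DistribLaw.mul_app' {C : Type u} [Category.{v} C] {S T : Monad C} (l : DistribLaw S T)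
    (X : C) : l.mul.app X = T.map (l.law.app (S.obj X) ≫ T.map (S.μ.app X)) ≫ T.μ.app (S.obj X) := by
  rw [l.mul_app, T.map_comp, Category.assoc, ← T.μ.naturality]; rfl

/-- The composite monad `TS` induced by a distributive law, with unit `η^T ∗ η^S`. -/
def DistribLaw.monad {C : Type u} [Category.{v} C] {S T : Monad C} (l : DistribLaw S T) :
    Monad C where
  toFunctor := S.toFunctor ⋙ T.toFunctor
  η := S.η ◫ T.η
  μ := l.mul
  assoc X := by
    have hn : ∀ {X Y : C} (f : X ⟶ Y), S.map (T.map f) ≫ l.law.app Y =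
      l.law.app X ≫ T.map (S.map f) := fun f => l.law.naturality f
    have e1 : S.map (l.mul.app X) ≫ l.law.app (S.obj X) ≫ T.map (S.μ.app X)
        = l.law.app (S.obj (T.obj (S.obj X))) ≫ T.map (S.μ.app _ ≫ l.law.app (S.obj X)
          ≫ T.map (S.μ.app X)) ≫ T.μ.app _ := by
      rw [l.mul_app']
      rw [S.map_comp, Category.assoc, reassoc_of% (l.pentagon_left (S.obj X)),
        reassoc_of% (hn (l.law.app (S.obj X) ≫ T.map (S.μ.app X)))]
      rw [← T.mu_naturality, reassoc_of% l.pentagon_right]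
      simp only [T.map_comp, S.map_comp, Category.assoc]
      rw [← T.map_comp_assoc (S.map (T.map _)), hn]
      simp only [T.map_comp, Category.assoc]
      rw [← T.map_comp_assoc (T.map (S.map _)), ← T.map_comp, S.assoc]
      simp
    have e2 : l.mul.app (T.obj (S.obj X)) = l.mul.app (T.obj (S.obj X)) := rfl
    change T.map (S.map (l.mul.app X)) ≫ l.mul.app X = l.mul.app (T.obj (S.obj X)) ≫ l.mul.app X
    rw [l.mul_app' X, ← T.map_comp_assoc, ← l.mul_app', e1]
    rw [l.mul_app' X, l.mul_app]
    simp only [T.map_comp, Category.assoc]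
    rw [T.assoc]
    simp only [← T.mu_naturality_assoc]
  left_unit X := by
    change (S.η ◫ T.η).app (T.obj (S.obj X)) ≫ l.mul.app X = 𝟙 (T.obj (S.obj X))
    rw [l.mul_app]
    simp only [NatTrans.hcomp_app, Functor.id_obj, Category.assoc]
    rw [← T.map_comp_assoc, l.triangle_right, T.mu_naturality_assoc, ← T.map_comp, S.left_unit]
    simp
  right_unit X := by
    change T.map (S.map ((S.η ◫ T.η).app X)) ≫ l.mul.app X = 𝟙 (T.obj (S.obj X))
    have hn := l.law.naturality (S.η.app X)
    simp only [Functor.comp_map] at hn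
    rw [l.mul_app']
    have h : (S.η ◫ T.η).app X = S.η.app X ≫ T.η.app (S.obj X) := by
      have := T.η.naturality (S.η.app X)
      rw [NatTrans.hcomp_app]
      exact this.symm
    rw [h, ← T.map_comp_assoc, S.map_comp, Category.assoc, reassoc_of% l.triangle_left,
      ← T.unit_naturality, ← Category.assoc (S.map _), S.right_unit]
    exact (congrArg (fun f => T.map f ≫ T.μ.app (S.obj X)) (Category.id_comp _)).trans
      (T.right_unit _)

noncomputable section

/-! ### The measurable space of bags

A bag on `X` is an element of `Multiset X`. -/

/-- The set `A^U_k` of bags that contain exactly `k` elements in `U`, with multiplicity. -/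
def bagSet {X : Type u} (U : Set X) (k : ℕ) : Set (Multiset X) :=
  open Classical in {b | b.countP (· ∈ U) = k}

/-- The σ-algebra on bags generated by the sets `A^U_k` with `U` measurable. -/
instance bagMeasurableSpace {X : Type u} [MeasurableSpace X] : MeasurableSpace (Multiset X) :=
  .generateFrom {A | ∃ U : Set X, MeasurableSet U ∧ ∃ k : ℕ, A = bagSet U k}

lemma measurable_bag_iff {X : Type u} [MeasurableSpace X] {Z : Type w} [MeasurableSpace Z]
    {f : Z → Multiset X} : Measurable f ↔
      open Classical in ∀ U, MeasurableSet U → Measurable fun z => (f z).countP (· ∈ U) := by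
  classical
  constructor
  · intro hf U hU
    refine measurable_to_countable' fun k => ?_
    exact hf (.basic _ ⟨U, hU, k, by simp [bagSet]⟩ : MeasurableSet (bagSet U k))
  · intro h
    refine measurable_generateFrom ?_
    rintro _ ⟨U, hU, k, rfl⟩
    have := h U hU (measurableSet_singleton k)
    convert this using 1
    ext z; simp only [bagSet, Set.mem_preimage, Set.mem_singleton_iff]
    exact Iff.rfl

lemma measurable_countP {X : Type u} [MeasurableSpace X] {U : Set X} (hU : MeasurableSet U) :
    open Classical in Measurable fun b : Multiset X => b.countP (· ∈ U) :=
  measurable_bag_iff.1 measurable_id U hU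

instance {X : Type u} [MeasurableSpace X] : MeasurableAdd₂ (Multiset X) := by
  classical
  refine ⟨measurable_bag_iff.2 fun U hU => ?_⟩
  simp only [Multiset.countP_add]
  exact ((measurable_countP hU).comp measurable_fst).add ((measurable_countP hU).comp measurable_snd)

lemma measurable_bagSingleton {X : Type u} [MeasurableSpace X] :
    Measurable fun x : X => ({x} : Multiset X) := by
  classical
  refine measurable_bag_iff.2 fun U hU => ?_
  have : (fun x : X => ({x} : Multiset X).countP (· ∈ U)) = fun x => if x ∈ U then 1 else 0 := by
    funext x
    rw [← Multiset.cons_zero, Multiset.countP_cons]; simp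
  rw [this]
  exact Measurable.ite hU measurable_const measurable_const

lemma measurable_bagMap {X : Type u} {Y : Type v} [MeasurableSpace X] [MeasurableSpace Y]
    {f : X → Y} (hf : Measurable f) : Measurable (Multiset.map f) := by
  classical
  refine measurable_bag_iff.2 fun U hU => ?_
  simp only [Multiset.countP_map, ← Multiset.countP_eq_card_filter]
  exact measurable_countP (hf hU)

/-- The function `K_n` that sends the tuple `(x₁, …, xₙ)` to the bag `[x₁, …, xₙ]`. -/
def bagOfTuple {X : Type u} {n : ℕ} (x : Fin n → X) : Multiset X := Multiset.ofList (List.ofFn x)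

lemma bagOfTuple_succ {X : Type u} {n : ℕ} (x : Fin (n + 1) → X) :
    bagOfTuple x = x 0 ::ₘ bagOfTuple (Fin.tail x) := by
  simp [bagOfTuple, List.ofFn_succ]; rfl

lemma bagOfTuple_surj {X : Type u} (b : Multiset X) :
    ∃ x : Fin (Multiset.card b) → X, bagOfTuple x = b := by
  induction b using Quotient.inductionOn with
  | h l => exact ⟨l.get, by simp [bagOfTuple]⟩

lemma bagOfTuple_perm {X : Type u} {n : ℕ} (x : Fin n → X) (σ : Equiv.Perm (Fin n)) :
    bagOfTuple (x ∘ σ) = bagOfTuple x :=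
  Multiset.coe_eq_coe.2 (Equiv.Perm.ofFn_comp_perm σ x)

lemma prod_bagOfTuple {X : Type u} {R : Type w} [CommMonoid R] {n : ℕ} (x : Fin n → X)
    (f : X → R) : ((bagOfTuple x).map f).prod = ∏ i, f (x i) := by
  simp [bagOfTuple, List.prod_ofFn, List.map_ofFn]

lemma measurable_bagOfTuple {X : Type u} [MeasurableSpace X] {n : ℕ} :
    Measurable (bagOfTuple : (Fin n → X) → Multiset X) := by
  induction n with
  | zero =>
    have : (bagOfTuple : (Fin 0 → X) → Multiset X) = fun _ => 0 := by
      funext x; simp [bagOfTuple]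
    rw [this]; exact measurable_const
  | succ n ih =>
    have : (bagOfTuple : (Fin (n + 1) → X) → Multiset X) =
        fun x => {x 0} + bagOfTuple (Fin.tail x) := by
      funext x; rw [bagOfTuple_succ, Multiset.singleton_add]
    rw [this]
    refine (measurable_bagSingleton.comp (measurable_pi_apply 0)).add (ih.comp ?_)
    exact measurable_pi_lambda _ fun i => measurable_pi_apply _

lemma measurable_prod_map {X : Type u} [MeasurableSpace X] {f : X → ℝ} (hf : Measurable f) :
    Measurable fun b : Multiset X => (b.map f).prod := by
  classical
  have hs : ∀ s : SimpleFunc X ℝ, Measurable fun b : Multiset X => (b.map s).prod := by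
    intro s
    have : (fun b : Multiset X => (b.map s).prod) =
        fun b => ∏ a ∈ s.range, a ^ (b.countP (· ∈ s ⁻¹' {a})) := by
      funext b
      induction b using Multiset.induction with
      | empty => simp
      | cons x b ih =>
        rw [Multiset.map_cons, Multiset.prod_cons, ih]
        simp only [Multiset.countP_cons, pow_add, Finset.prod_mul_distrib]
        rw [mul_comm]
        congr 1
        simp only [Set.mem_preimage, Set.mem_singleton_iff, pow_ite, pow_one, pow_zero]
        rw [Finset.prod_ite_eq]
        simp
    rw [this]
    refine Finset.measurable_prod _ fun a _ => ?_
    exact (measurable_from_top (f := fun k : ℕ => a ^ k)).comp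
      (measurable_countP (s.measurableSet_fiber a))
  refine measurable_of_tendsto_metrizable (fun n => hs (hf.stronglyMeasurable.approx n)) ?_
  refine tendsto_pi_nhds.2 fun b => ?_
  exact tendsto_multiset_prod b fun x _ => hf.stronglyMeasurable.tendsto_approx x

/-- Ryser's formula for the permanent. -/
lemma sum_perm_prod {n : ℕ} (a : Fin n → Fin n → ℝ) :
    ∑ σ : Equiv.Perm (Fin n), ∏ i, a i (σ i) =
      ∑ S : Finset (Fin n), (-1 : ℝ) ^ S.card * ∏ i, ∑ j ∈ Sᶜ, a i j := by
  classical
  have h1 : ∀ S : Finset (Fin n), ∏ i, ∑ j ∈ Sᶜ, a i j =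
      ∑ f : Fin n → Fin n, if S ⊆ (Finset.univ.image f)ᶜ then ∏ i, a i (f i) else 0 := by
    intro S
    rw [Finset.prod_univ_sum, ← Finset.sum_filter]
    refine Finset.sum_congr ?_ fun _ _ => rfl
    ext f
    simp only [Fintype.mem_piFinset, Finset.mem_compl, Finset.mem_filter, Finset.mem_univ, true_and,
      Finset.subset_iff, Finset.mem_image, not_exists]
    constructor
    · intro h s hs i hi
      exact h i (hi ▸ hs)
    · intro h i hi
      exact h hi i rfl
  simp_rw [h1, Finset.mul_sum]
  rw [Finset.sum_comm]
  have h2 : ∀ f : Fin n → Fin n, (∑ S : Finset (Fin n), (-1 : ℝ) ^ S.card *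
      (if S ⊆ (Finset.univ.image f)ᶜ then ∏ i, a i (f i) else 0)) =
      if Function.Bijective f then ∏ i, a i (f i) else 0 := by
    intro f
    have h3 : (∑ S ∈ ((Finset.univ.image f)ᶜ).powerset, (-1 : ℝ) ^ S.card) =
        if Function.Bijective f then 1 else 0 := by
      have := Finset.sum_powerset_neg_one_pow_card (x := (Finset.univ.image f)ᶜ)
      have h4 := congrArg (Int.cast : ℤ → ℝ) this
      push_cast at h4
      rw [h4]
      have h5 : (Finset.univ.image f)ᶜ = ∅ ↔ Function.Bijective f := by
        rw [Finset.compl_eq_empty_iff, Finset.eq_univ_iff_forall, ← Finite.surjective_iff_bijective]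
        simp [Function.Surjective]
      simp [h5]
    have h6 : (if Function.Bijective f then ∏ i, a i (f i) else 0) =
        (if Function.Bijective f then (1 : ℝ) else 0) * ∏ i, a i (f i) := by simp
    rw [h6, ← h3, Finset.sum_mul]
    simp only [mul_ite, mul_zero]
    rw [← Finset.sum_filter]
    refine Finset.sum_congr ?_ fun _ _ => rfl
    ext; simp
  simp_rw [h2]
  rw [← Finset.sum_filter]
  refine Finset.sum_bij (fun σ _ => ⇑σ) ?_ ?_ ?_ ?_
  · intro σ _; exact Finset.mem_filter.2 ⟨Finset.mem_univ _, σ.bijective⟩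
  · intro σ _ τ _ h; exact DFunLike.coe_injective h
  · intro f hf
    exact ⟨Equiv.ofBijective f (Finset.mem_filter.1 hf).2, Finset.mem_univ _, rfl⟩
  · intro σ _; rfl

/-- Symmetrizing the indicator of a measurable set of tuples gives a measurable function of bags. -/
lemma exists_symmetrization {X : Type u} [MeasurableSpace X] {n : ℕ} {S : Set (Fin n → X)}
    (hS : MeasurableSet S) : ∃ g : Multiset X → ℝ≥0∞, Measurable g ∧ ∀ x : Fin n → X,
      g (bagOfTuple x) = ∑ σ : Equiv.Perm (Fin n), S.indicator 1 (x ∘ σ) := by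
  classical
  have hgen := (generateFrom_pi (α := fun _ : Fin n => X)).symm
  have hpi := isPiSystem_pi (α := fun _ : Fin n => X)
  induction S, hS using MeasurableSpace.induction_on_inter hgen hpi with
  | empty => exact ⟨0, measurable_zero, by simp⟩
  | basic S hS =>
    obtain ⟨U, hU, rfl⟩ := hS
    have hU : ∀ i, MeasurableSet (U i) := fun i => hU i (Set.mem_univ i)
    refine ⟨fun b => ENNReal.ofReal (∑ T : Finset (Fin n), (-1 : ℝ) ^ T.card *
      (b.map fun y => ∑ j ∈ Tᶜ, (U j).indicator 1 y).prod), ?_, fun x => ?_⟩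
    · refine ENNReal.measurable_ofReal.comp (Finset.measurable_sum _ fun T _ => ?_)
      refine measurable_const.mul (measurable_prod_map ?_)
      exact Finset.measurable_sum _ fun j _ => measurable_one.indicator (hU j)
    · simp only [prod_bagOfTuple]
      rw [← sum_perm_prod fun i j => (U j).indicator 1 (x i)]
      rw [ENNReal.ofReal_sum_of_nonneg fun σ _ => Finset.prod_nonneg fun i _ =>
        Set.indicator_nonneg (by simp) _]
      rw [← Equiv.sum_comp (Equiv.inv (Equiv.Perm (Fin n)))]
      refine Finset.sum_congr rfl fun σ _ => ?_
      have : ∏ i, (U ((Equiv.inv (Equiv.Perm (Fin n)) σ) i)).indicator (1 : X → ℝ) (x i) =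
          ∏ i, (U i).indicator (1 : X → ℝ) (x (σ i)) := by
        rw [← Equiv.prod_comp σ]; simp
      rw [this]
      by_cases h : ∀ i, x (σ i) ∈ U i
      · rw [Set.indicator_of_mem (by simpa using h)]
        simp [h]
      · rw [Set.indicator_of_notMem (by simpa using h)]
        push Not at h
        obtain ⟨i, hi⟩ := h
        rw [Finset.prod_eq_zero (Finset.mem_univ i) (by simp [hi])]
        simp
  | compl S _ ih =>
    obtain ⟨g, hg, h⟩ := ih
    refine ⟨fun b => (Fintype.card (Equiv.Perm (Fin n)) : ℝ≥0∞) - g b, measurable_const.sub hg,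
      fun x => ?_⟩
    simp only [h]
    have hle : ∑ σ : Equiv.Perm (Fin n), S.indicator (1 : (Fin n → X) → ℝ≥0∞) (x ∘ σ) ≠ ∞ := by
      refine ENNReal.sum_ne_top.2 fun σ _ => ?_
      by_cases hx : x ∘ σ ∈ S <;> simp [hx]
    refine (ENNReal.eq_sub_of_add_eq hle ?_).symm
    rw [← Finset.sum_add_distrib]
    simp [Set.indicator_compl_add_self_apply]
  | iUnion f hd _ ih =>
    choose g hg h using ih
    refine ⟨fun b => ∑' i, g i b, Measurable.tsum hg, fun x => ?_⟩
    simp only [h]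
    rw [Summable.tsum_finsetSum fun _ _ => ENNReal.summable]
    refine Finset.sum_congr rfl fun σ _ => ?_
    by_cases hx : ∃ i, x ∘ σ ∈ f i
    · obtain ⟨i, hi⟩ := hx
      rw [tsum_eq_single i, Set.indicator_of_mem hi, Set.indicator_of_mem (Set.mem_iUnion.2 ⟨i, hi⟩)]
      intro j hj
      exact Set.indicator_of_notMem (fun hj' => Set.disjoint_left.1 (hd hj) hj' hi) _
    · rw [Set.indicator_of_notMem (by simpa using hx)]
      push Not at hx
      simp [hx]

/-- A function on bags is measurable if it is so as a function of `n`-tuples for every `n`. -/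
lemma measurable_of_bagOfTuple {X : Type u} [MeasurableSpace X] {Z : Type w} [MeasurableSpace Z]
    {f : Multiset X → Z} (hf : ∀ n, Measurable fun x : Fin n → X => f (bagOfTuple x)) :
    Measurable f := by
  intro W hW
  choose g hg h using fun n => exists_symmetrization (hf n hW)
  have key : f ⁻¹' W = {b | g (Multiset.card b) b ≠ 0} := by
    ext b
    obtain ⟨x, hx⟩ := bagOfTuple_surj b
    have h0 : g (Multiset.card b) b = ∑ σ : Equiv.Perm (Fin (Multiset.card b)),
      ((fun x : Fin (Multiset.card b) → X => f (bagOfTuple x)) ⁻¹' W).indicator 1 (x ∘ σ) := by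
      rw [← h, hx]
    rw [Set.mem_ofPred_eq, h0]
    have : ∀ σ : Equiv.Perm (Fin (Multiset.card b)),
      ((fun x : Fin (Multiset.card b) → X => f (bagOfTuple x)) ⁻¹' W).indicator
        (1 : (Fin (Multiset.card b) → X) → ℝ≥0∞) (x ∘ σ) = W.indicator 1 (f b) := by
      intro σ
      have hm : (x ∘ σ ∈ (fun x : Fin (Multiset.card b) → X => f (bagOfTuple x)) ⁻¹' W) ↔ f b ∈ W := by
        change f (bagOfTuple (x ∘ σ)) ∈ W ↔ _
        rw [bagOfTuple_perm, hx]
      by_cases hb : f b ∈ W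
      · rw [Set.indicator_of_mem hb, Set.indicator_of_mem (hm.2 hb)]; rfl
      · rw [Set.indicator_of_notMem hb, Set.indicator_of_notMem (mt hm.1 hb)]
    simp only [this]
    by_cases hb : f b ∈ W <;> simp [hb]
  rw [key]
  classical
  have hc : Measurable (Multiset.card : Multiset X → ℕ) := by
    simpa using measurable_countP (X := X) MeasurableSet.univ
  have : Measurable fun b : Multiset X => g (Multiset.card b) b :=
    measurable_from_prod_countable_right (f := fun p : ℕ × Multiset X => g p.1 p.2) (fun n => hg n)
      |>.comp (hc.prodMk measurable_id)
  exact (this (measurableSet_singleton 0)).compl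


/-! ### The Giry monad of probability measures -/

lemma measurable_toMeasure {X : Type u} [MeasurableSpace X] :
    Measurable (ProbabilityMeasure.toMeasure : ProbabilityMeasure X → Measure X) :=
  measurable_subtype_coe

lemma measurable_probabilityMeasure {X : Type u} {Z : Type v} [MeasurableSpace X]
    [MeasurableSpace Z] {f : Z → ProbabilityMeasure X} (hf : Measurable fun z => (f z).toMeasure) :
    Measurable f :=
  Measurable.subtype_mk hf (h := fun z => (f z).2)

/-- The push-forward `ν ∘ f⁻¹` of a probability measure along a measurable function. -/
def push {X : Type u} {Y : Type v} [MeasurableSpace X] [MeasurableSpace Y] (f : X → Y)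
    (hf : Measurable f) (ν : ProbabilityMeasure X) : ProbabilityMeasure Y :=
  ⟨ν.toMeasure.map f, Measure.isProbabilityMeasure_map hf.aemeasurable⟩

@[simp] lemma push_toMeasure {X : Type u} {Y : Type v} [MeasurableSpace X] [MeasurableSpace Y]
    {f : X → Y} {hf : Measurable f} {ν : ProbabilityMeasure X} :
    (push f hf ν).toMeasure = ν.toMeasure.map f := rfl

lemma measurable_push {X : Type u} {Y : Type v} [MeasurableSpace X] [MeasurableSpace Y] {f : X → Y}
    (hf : Measurable f) : Measurable (push f hf) :=
  measurable_probabilityMeasure ((Measure.measurable_map f hf).comp measurable_toMeasure)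

/-- The Dirac measure `δ_x` as a probability measure. -/
def giryUnit {X : Type u} [MeasurableSpace X] (x : X) : ProbabilityMeasure X :=
  ⟨Measure.dirac x, inferInstance⟩

@[simp] lemma giryUnit_toMeasure {X : Type u} [MeasurableSpace X] {x : X} :
    (giryUnit x).toMeasure = Measure.dirac x := rfl

lemma measurable_giryUnit {X : Type u} [MeasurableSpace X] :
    Measurable (giryUnit : X → ProbabilityMeasure X) :=
  measurable_probabilityMeasure Measure.measurable_dirac

/-- The multiplication `ν ↦ (U ↦ ∫ ξ(U) dν(ξ))` of the Giry monad. -/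
def giryMul {X : Type u} [MeasurableSpace X] (ν : ProbabilityMeasure (ProbabilityMeasure X)) :
    ProbabilityMeasure X :=
  ⟨(ν.toMeasure.map ProbabilityMeasure.toMeasure).join, ⟨by
    rw [Measure.join_apply .univ, lintegral_map (Measure.measurable_coe .univ) measurable_toMeasure]
    simp⟩⟩

@[simp] lemma giryMul_toMeasure {X : Type u} [MeasurableSpace X]
    {ν : ProbabilityMeasure (ProbabilityMeasure X)} :
    (giryMul ν).toMeasure = (ν.toMeasure.map ProbabilityMeasure.toMeasure).join := rfl

lemma giryMul_apply {X : Type u} [MeasurableSpace X] (ν : ProbabilityMeasure (ProbabilityMeasure X))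
    {U : Set X} (hU : MeasurableSet U) :
    (giryMul ν).toMeasure U = ∫⁻ ξ, ξ.toMeasure U ∂ν.toMeasure := by
  rw [giryMul_toMeasure, Measure.join_apply hU,
    lintegral_map (Measure.measurable_coe hU) measurable_toMeasure]

lemma lintegral_giryMul {X : Type u} [MeasurableSpace X]
    (ν : ProbabilityMeasure (ProbabilityMeasure X)) {f : X → ℝ≥0∞} (hf : Measurable f) :
    ∫⁻ x, f x ∂(giryMul ν).toMeasure = ∫⁻ ξ, ∫⁻ x, f x ∂ξ.toMeasure ∂ν.toMeasure := by
  rw [giryMul_toMeasure, Measure.lintegral_join hf.aemeasurable,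
    lintegral_map (Measure.measurable_lintegral hf) measurable_toMeasure]

lemma measurable_giryMul {X : Type u} [MeasurableSpace X] :
    Measurable (giryMul : ProbabilityMeasure (ProbabilityMeasure X) → ProbabilityMeasure X) :=
  measurable_probabilityMeasure (Measure.measurable_join.comp
    ((Measure.measurable_map _ measurable_toMeasure).comp measurable_toMeasure))

lemma probabilityMeasure_ext {X : Type u} [MeasurableSpace X] {μ ν : ProbabilityMeasure X}
    (h : ∀ f : X → ℝ≥0∞, Measurable f → ∫⁻ x, f x ∂μ.toMeasure = ∫⁻ x, f x ∂ν.toMeasure) :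
    μ = ν :=
  Subtype.ext (Measure.ext_of_lintegral _ h)

lemma lintegral_push {X : Type u} {Y : Type v} [MeasurableSpace X] [MeasurableSpace Y]
    {f : X → Y} {hf : Measurable f} {ν : ProbabilityMeasure X} {g : Y → ℝ≥0∞} (hg : Measurable g) :
    ∫⁻ y, g y ∂(push f hf ν).toMeasure = ∫⁻ x, g (f x) ∂ν.toMeasure :=
  lintegral_map hg hf

lemma lintegral_giryUnit {X : Type u} [MeasurableSpace X] {x : X} {g : X → ℝ≥0∞}
    (hg : Measurable g) : ∫⁻ y, g y ∂(giryUnit x).toMeasure = g x :=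
  lintegral_dirac' x hg

lemma measurable_lintegral_toMeasure {X : Type u} [MeasurableSpace X] {f : X → ℝ≥0∞}
    (hf : Measurable f) : Measurable fun ξ : ProbabilityMeasure X => ∫⁻ x, f x ∂ξ.toMeasure :=
  (Measure.measurable_lintegral hf).comp measurable_toMeasure

lemma push_push {X : Type u} {Y : Type v} {Z : Type w} [MeasurableSpace X] [MeasurableSpace Y]
    [MeasurableSpace Z] {f : X → Y} {g : Y → Z} (hf : Measurable f) (hg : Measurable g)
    (ν : ProbabilityMeasure X) : push g hg (push f hf ν) = push (g ∘ f) (hg.comp hf) ν :=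
  Subtype.ext (Measure.map_map hg hf)

lemma push_giryUnit {X : Type u} {Y : Type v} [MeasurableSpace X] [MeasurableSpace Y]
    {f : X → Y} (hf : Measurable f) (x : X) : push f hf (giryUnit x) = giryUnit (f x) :=
  Subtype.ext (Measure.map_dirac' hf x)

lemma giryMul_giryUnit {X : Type u} [MeasurableSpace X] (ν : ProbabilityMeasure X) :
    giryMul (giryUnit ν) = ν :=
  probabilityMeasure_ext fun f hf => by
    rw [lintegral_giryMul _ hf, lintegral_giryUnit (measurable_lintegral_toMeasure hf)]

lemma push_giryMul {X : Type u} {Y : Type v} [MeasurableSpace X] [MeasurableSpace Y]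
    {f : X → Y} (hf : Measurable f) (ν : ProbabilityMeasure (ProbabilityMeasure X)) :
    push f hf (giryMul ν) = giryMul (push (push f hf) (measurable_push hf) ν) :=
  probabilityMeasure_ext fun g hg => by
    have hgf : Measurable fun x => g (f x) := hg.comp hf
    rw [lintegral_push hg, lintegral_giryMul _ hgf, lintegral_giryMul _ hg,
      lintegral_push (measurable_lintegral_toMeasure hg)]
    simp only [lintegral_push hg]

lemma giryMul_push_giryUnit {X : Type u} [MeasurableSpace X] (ν : ProbabilityMeasure X) :
    giryMul (push giryUnit measurable_giryUnit ν) = ν :=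
  probabilityMeasure_ext fun f hf => by
    rw [lintegral_giryMul _ hf, lintegral_push (measurable_lintegral_toMeasure hf)]
    simp only [lintegral_giryUnit hf]

/-- The Giry monad `G`: probability measures with the σ-algebra generated by the evaluations. -/
def giry : CategoryTheory.Monad MeasCat.{u} where
  obj X := MeasCat.of (ProbabilityMeasure X)
  map f := ⟨push f.1 f.2, measurable_push f.2⟩
  map_id X := Subtype.ext <| funext fun ν => Subtype.ext Measure.map_id
  map_comp f g := Subtype.ext <| funext fun ν => (push_push f.2 g.2 ν).symm
  η :=
    { app X := ⟨giryUnit, measurable_giryUnit⟩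
      naturality _ _ f := Subtype.ext <| funext fun x => (push_giryUnit f.2 x).symm }
  μ :=
    { app X := ⟨giryMul, measurable_giryMul⟩
      naturality _ _ f := Subtype.ext <| funext fun ν => (push_giryMul f.2 ν).symm }
  assoc X := Subtype.ext <| funext fun ν => probabilityMeasure_ext fun f hf => by
    change ∫⁻ x, f x ∂(giryMul (push giryMul measurable_giryMul ν)).toMeasure =
      ∫⁻ x, f x ∂(giryMul (giryMul ν)).toMeasure
    rw [lintegral_giryMul _ hf, lintegral_giryMul _ hf,
      lintegral_push (measurable_lintegral_toMeasure hf),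
      lintegral_giryMul _ (measurable_lintegral_toMeasure hf)]
    simp only [lintegral_giryMul _ hf]
  left_unit X := Subtype.ext <| funext fun ν => giryMul_giryUnit ν
  right_unit X := Subtype.ext <| funext fun ν => giryMul_push_giryUnit (X := X) ν

/-! ### The bag monad -/

lemma measurable_bagSum {X : Type u} [MeasurableSpace X] :
    Measurable (Multiset.join : Multiset (Multiset X) → Multiset X) := by
  refine measurable_of_bagOfTuple fun n => ?_
  have : (fun x : Fin n → Multiset X => Multiset.join (bagOfTuple x)) = fun x => ∑ i, x i := by
    funext x
    simp [Multiset.join, bagOfTuple, List.sum_ofFn]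
  rw [this]
  exact Finset.measurable_sum _ fun i _ => measurable_pi_apply i

/-- The bag monad `B` on measurable spaces: `B f` applies `f` to every element, the unit is
`x ↦ [x]` and the multiplication is the union with multiplicities. -/
def bag : CategoryTheory.Monad MeasCat.{u} where
  obj X := MeasCat.of (Multiset X)
  map f := ⟨Multiset.map f.1, measurable_bagMap f.2⟩
  map_id X := Subtype.ext <| funext fun b => Multiset.map_id b
  map_comp f g := Subtype.ext <| funext fun b => (Multiset.map_map g.1 f.1 b).symm
  η :=
    { app X := ⟨fun x => {x}, measurable_bagSingleton⟩
      naturality _ _ f := Subtype.ext <| funext fun x => (Multiset.map_singleton f.1 x).symm }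
  μ :=
    { app X := ⟨Multiset.join, measurable_bagSum⟩
      naturality _ _ f := Subtype.ext <| funext fun b => (Multiset.map_join f.1 b).symm }
  assoc X := Subtype.ext <| funext fun b => by
    change Multiset.join (Multiset.map Multiset.join b) = Multiset.join (Multiset.join b)
    induction b using Multiset.induction with
    | empty => rfl
    | cons a b ih => simp [ih]
  left_unit X := Subtype.ext <| funext fun b => Multiset.singleton_join b
  right_unit X := Subtype.ext <| funext fun b => by
    change Multiset.join (Multiset.map (fun x => {x}) b) = b
    induction b using Multiset.induction with
    | empty => rfl
    | cons a b ih =>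
      rw [Multiset.map_cons, Multiset.join_cons, Multiset.singleton_add]
      exact congrArg (a ::ₘ ·) ih

/-! ### The distributive law -/

/-- The law of the bag `[x₁, …, xₙ]` for independent `xᵢ ∼ νᵢ`: the push-forward of the product
measure `ν₁ ⊗ ⋯ ⊗ νₙ` along the function that sends a tuple to the bag of its entries. -/
def tupleLaw {X : Type u} [MeasurableSpace X] {n : ℕ} (ν : Fin n → ProbabilityMeasure X) :
    ProbabilityMeasure (Multiset X) :=
  ⟨(Measure.pi fun i => (ν i).toMeasure).map bagOfTuple,
    Measure.isProbabilityMeasure_map measurable_bagOfTuple.aemeasurable⟩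

/-- Convolution, i.e. the law of the sum of independent variables; an auxiliary tool. -/
def convolve {M : Type u} [AddMonoid M] [MeasurableSpace M] [MeasurableAdd₂ M]
    (p q : ProbabilityMeasure M) : ProbabilityMeasure M :=
  ⟨p.toMeasure.conv q.toMeasure, inferInstance⟩

lemma lintegral_conv {M : Type u} [AddMonoid M] [MeasurableSpace M] [MeasurableAdd₂ M]
    {p q : ProbabilityMeasure M} {f : M → ℝ≥0∞} (hf : Measurable f) :
    ∫⁻ x, f x ∂(convolve p q).toMeasure = ∫⁻ x, ∫⁻ y, f (x + y) ∂q.toMeasure ∂p.toMeasure :=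
  Measure.lintegral_conv hf

lemma measurable_conv {M : Type u} [AddMonoid M] [MeasurableSpace M] [MeasurableAdd₂ M] :
    Measurable fun p : ProbabilityMeasure M × ProbabilityMeasure M => convolve p.1 p.2 :=
  measurable_probabilityMeasure
    ((Measure.measurable_map _ measurable_add).comp ProbabilityMeasure.measurable_fun_prod)

lemma conv_left_comm {M : Type u} [AddCommMonoid M] [MeasurableSpace M] [MeasurableAdd₂ M]
    (p q r : ProbabilityMeasure M) : convolve p (convolve q r) = convolve q (convolve p r) := by
  refine Subtype.ext ?_
  change p.toMeasure.conv (q.toMeasure.conv r.toMeasure) =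
    q.toMeasure.conv (p.toMeasure.conv r.toMeasure)
  rw [← Measure.conv_assoc, Measure.conv_comm p.toMeasure, Measure.conv_assoc]

lemma conv_assoc {M : Type u} [AddMonoid M] [MeasurableSpace M] [MeasurableAdd₂ M]
    (p q r : ProbabilityMeasure M) : convolve (convolve p q) r = convolve p (convolve q r) :=
  Subtype.ext (Measure.conv_assoc _ _ _)

lemma conv_zero {M : Type u} [AddMonoid M] [MeasurableSpace M] [MeasurableAdd₂ M]
    (p : ProbabilityMeasure M) : convolve p (giryUnit 0) = p :=
  Subtype.ext (Measure.conv_dirac_zero _)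

lemma zero_conv {M : Type u} [AddMonoid M] [MeasurableSpace M] [MeasurableAdd₂ M]
    (p : ProbabilityMeasure M) : convolve (giryUnit 0) p = p :=
  Subtype.ext (Measure.dirac_zero_conv _)

lemma push_conv {M : Type u} {N : Type v} [AddMonoid M] [MeasurableSpace M] [MeasurableAdd₂ M]
    [AddMonoid N] [MeasurableSpace N] [MeasurableAdd₂ N] (f : M →+ N) (hf : Measurable f)
    (p q : ProbabilityMeasure M) : push f hf (convolve p q) = convolve (push f hf p) (push f hf q) :=
  Subtype.ext (Measure.map_conv_addMonoidHom f hf)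

lemma giryMul_push_conv {M : Type u} {N : Type v} [AddMonoid M] [MeasurableSpace M]
    [MeasurableAdd₂ M] [AddMonoid N] [MeasurableSpace N] [MeasurableAdd₂ N]
    (f : M → ProbabilityMeasure N) (hf : Measurable f)
    (hadd : ∀ a b, f (a + b) = convolve (f a) (f b)) (p q : ProbabilityMeasure M) :
    giryMul (push f hf (convolve p q)) = convolve (giryMul (push f hf p)) (giryMul (push f hf q)) := by
  refine probabilityMeasure_ext fun g hg => ?_
  have hI := measurable_lintegral_toMeasure hg
  have hIf : Measurable fun m => ∫⁻ x, g x ∂(f m).toMeasure := hI.comp hf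
  rw [lintegral_giryMul _ hg, lintegral_push hI, lintegral_conv hIf, lintegral_conv hg]
  have h2 : Measurable fun x => ∫⁻ y, g (x + y) ∂(giryMul (push f hf q)).toMeasure :=
    Measurable.lintegral_prod_right' (f := fun z : N × N => g (z.1 + z.2)) (hg.comp measurable_add)
  rw [lintegral_giryMul _ h2, lintegral_push (measurable_lintegral_toMeasure h2)]
  refine lintegral_congr fun a => ?_
  have h3 : ∀ x, ∫⁻ y, g (x + y) ∂(giryMul (push f hf q)).toMeasure =
      ∫⁻ b, ∫⁻ y, g (x + y) ∂(f b).toMeasure ∂q.toMeasure := fun x => by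
    have hx : Measurable fun y => g (x + y) := hg.comp (measurable_const_add x)
    rw [lintegral_giryMul _ hx, lintegral_push (measurable_lintegral_toMeasure hx)]
  simp only [h3, hadd, lintegral_conv hg]
  rw [lintegral_lintegral_swap]
  have h4 : Measurable fun z : (M × N) × N => g (z.1.2 + z.2) := by fun_prop
  let κ : ProbabilityTheory.Kernel M N := ⟨fun b => (f b).toMeasure, measurable_toMeasure.comp hf⟩
  have : ProbabilityTheory.IsMarkovKernel κ := ⟨fun b => (f b).2⟩
  have h5 := h4.lintegral_kernel_prod_right' (κ := κ.comap (Prod.fst : M × N → M) measurable_fst)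
  exact h5.aemeasurable

lemma tupleLaw_succ {X : Type u} [MeasurableSpace X] {n : ℕ}
    (ν : Fin (n + 1) → ProbabilityMeasure X) :
    tupleLaw ν = convolve (push (fun x => {x}) measurable_bagSingleton (ν 0))
      (tupleLaw (Fin.tail ν)) := by
  refine Subtype.ext ?_
  change (Measure.pi fun i => (ν i).toMeasure).map bagOfTuple =
    (((ν 0).toMeasure.map fun x => {x}).conv
      ((Measure.pi fun i => (Fin.tail ν i).toMeasure).map bagOfTuple))
  have h := (measurePreserving_piFinSuccAbove (fun i => (ν i).toMeasure) 0)
  unfold Measure.conv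
  rw [Measure.map_prod_map _ _ measurable_bagSingleton measurable_bagOfTuple,
    Measure.map_map measurable_add (measurable_bagSingleton.prodMap measurable_bagOfTuple)]
  have h' := h.map_eq
  simp only [Fin.zero_succAbove] at h'
  change _ = Measure.map _ ((ν 0).toMeasure.prod (Measure.pi fun i : Fin n => (ν i.succ).toMeasure))
  rw [← h', Measure.map_map _ h.measurable]
  · congr 1
    funext x
    simp [bagOfTuple_succ]
  · exact measurable_add.comp (measurable_bagSingleton.prodMap measurable_bagOfTuple)

lemma tupleLaw_zero {X : Type u} [MeasurableSpace X] (ν : Fin 0 → ProbabilityMeasure X) :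
    tupleLaw ν = giryUnit 0 := by
  refine Subtype.ext ?_
  change (Measure.pi fun i => (ν i).toMeasure).map bagOfTuple = Measure.dirac 0
  rw [Measure.pi_of_empty, Measure.map_dirac' measurable_bagOfTuple]
  simp [bagOfTuple]

lemma tupleLaw_perm {X : Type u} [MeasurableSpace X] {l₁ l₂ : List (ProbabilityMeasure X)}
    (h : l₁.Perm l₂) : tupleLaw l₁.get = tupleLaw l₂.get := by
  have hc : ∀ (ν : ProbabilityMeasure X) (l : List (ProbabilityMeasure X)),
      tupleLaw (ν :: l).get = convolve (push (fun x => {x}) measurable_bagSingleton ν)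
        (tupleLaw l.get) := fun ν l => tupleLaw_succ _
  induction h with
  | nil => rfl
  | cons x _ ih => rw [hc, hc, ih]
  | swap x y l => rw [hc, hc, hc, hc, conv_left_comm]
  | trans _ _ ih₁ ih₂ => exact ih₁.trans ih₂

/-- `[ν₁, …, νₙ] ↦ (Kₙ)⁎ (ν₁ ⊗ ⋯ ⊗ νₙ)`, a well-defined function on bags of probability measures. -/
def bagLaw {X : Type u} [MeasurableSpace X] (b : Multiset (ProbabilityMeasure X)) :
    ProbabilityMeasure (Multiset X) :=
  Quotient.lift (fun l : List (ProbabilityMeasure X) => tupleLaw l.get)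
    (fun _ _ h => tupleLaw_perm h) b

@[simp] lemma bagLaw_zero {X : Type u} [MeasurableSpace X] :
    bagLaw (0 : Multiset (ProbabilityMeasure X)) = giryUnit 0 := tupleLaw_zero _

@[simp] lemma bagLaw_cons {X : Type u} [MeasurableSpace X] (ν : ProbabilityMeasure X)
    (b : Multiset (ProbabilityMeasure X)) : bagLaw (ν ::ₘ b) =
      convolve (push (fun x => {x}) measurable_bagSingleton ν) (bagLaw b) := by
  induction b using Quotient.inductionOn with
  | h l => exact tupleLaw_succ _

lemma bagLaw_singleton {X : Type u} [MeasurableSpace X] (ν : ProbabilityMeasure X) :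
    bagLaw {ν} = push (fun x => {x}) measurable_bagSingleton ν := by
  rw [← Multiset.cons_zero, bagLaw_cons, bagLaw_zero, conv_zero]

lemma bagLaw_add {X : Type u} [MeasurableSpace X] (b c : Multiset (ProbabilityMeasure X)) :
    bagLaw (b + c) = convolve (bagLaw b) (bagLaw c) := by
  induction b using Multiset.induction with
  | empty => simp [zero_conv]
  | cons ν b ih => rw [Multiset.cons_add, bagLaw_cons, ih, bagLaw_cons, conv_assoc]

lemma measurable_bagLaw {X : Type u} [MeasurableSpace X] :
    Measurable (bagLaw : Multiset (ProbabilityMeasure X) → ProbabilityMeasure (Multiset X)) := by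
  refine measurable_of_bagOfTuple fun n => ?_
  induction n with
  | zero => exact measurable_const' fun x y => by simp [bagOfTuple]
  | succ n ih =>
    simp only [bagOfTuple_succ, bagLaw_cons]
    refine measurable_conv.comp (Measurable.prodMk ?_ ?_)
    · exact (measurable_push measurable_bagSingleton).comp (measurable_pi_apply 0)
    · exact ih.comp (measurable_pi_lambda _ fun i => measurable_pi_apply _)

lemma push_bagLaw {X : Type u} {Y : Type v} [MeasurableSpace X] [MeasurableSpace Y]
    {f : X → Y} (hf : Measurable f) (b : Multiset (ProbabilityMeasure X)) :
    push (Multiset.map f) (measurable_bagMap hf) (bagLaw b) = bagLaw (b.map (push f hf)) := by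
  induction b using Multiset.induction with
  | empty => simp [push_giryUnit]
  | cons ν b ih =>
    rw [bagLaw_cons, Multiset.map_cons, bagLaw_cons, ← ih]
    refine (push_conv (Multiset.mapAddMonoidHom f) (measurable_bagMap hf) _ _).trans ?_
    congr 1
    exact (push_push measurable_bagSingleton (measurable_bagMap hf) ν).trans
      (push_push hf measurable_bagSingleton ν).symm

/-- The distributive law `l : BG → GB` of the Giry monad over the bag monad. -/
def bagGiryLaw : DistribLaw bag.{u} giry.{u} where
  law :=
    { app X := ⟨bagLaw, measurable_bagLaw⟩
      naturality _ _ f := Subtype.ext <| funext fun b => (push_bagLaw f.2 b).symm }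
  triangle_left X := Subtype.ext <| funext fun (b : Multiset X) => by
    change bagLaw (b.map giryUnit) = giryUnit b
    induction b using Multiset.induction with
    | empty => simp
    | cons x b ih =>
      rw [Multiset.map_cons, bagLaw_cons, ih, push_giryUnit]
      exact Subtype.ext (Measure.dirac_conv_dirac _ _)
  triangle_right X := Subtype.ext <| funext fun ν => bagLaw_singleton ν
  pentagon_left X := Subtype.ext <| funext fun
      (b : Multiset (ProbabilityMeasure (ProbabilityMeasure X))) => by
    change bagLaw (b.map giryMul) = giryMul (push bagLaw measurable_bagLaw (bagLaw b))
    induction b using Multiset.induction with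
    | empty => simp [push_giryUnit, giryMul_giryUnit]
    | cons ν b ih =>
      rw [Multiset.map_cons, bagLaw_cons, ih, bagLaw_cons,
        giryMul_push_conv _ _ bagLaw_add, push_push, push_giryMul]
      congr 3
      funext ξ
      exact (bagLaw_singleton ξ).symm
  pentagon_right X := Subtype.ext <| funext fun
      (b : Multiset (Multiset (ProbabilityMeasure X))) => by
    change bagLaw b.join = push Multiset.join measurable_bagSum (bagLaw (b.map bagLaw))
    induction b using Multiset.induction with
    | empty => simp [push_giryUnit]
    | cons c b ih =>
      rw [Multiset.join_cons, bagLaw_add, ih, Multiset.map_cons, bagLaw_cons]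
      symm
      refine (push_conv (⟨⟨Multiset.join, rfl⟩, Multiset.join_add⟩ :
        Multiset (Multiset X) →+ Multiset X) measurable_bagSum _ _).trans ?_
      rw [push_push]
      congr 1
      refine Subtype.ext ?_
      change Measure.map _ _ = _
      have : ((⟨⟨Multiset.join, rfl⟩, Multiset.join_add⟩ :
        Multiset (Multiset X) →+ Multiset X) ∘ fun x => {x}) = id :=
        funext fun x => Multiset.singleton_join x
      rw [this, Measure.map_id]
      rfl

/-- The point-process monad `GB`, with unit `η^G ∗ η^B` and multiplication `(μ^G ∗ μ^B) ∘ G l B`. -/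
def pointProcess : CategoryTheory.Monad MeasCat.{u} := bagGiryLaw.monad

/-! ### The intensity -/

/-- The inclusion `i^G : G → M` of probability measures into all measures; `M` is Mathlib's
`MeasCat.Giry`, whose functor sends `X` to the space of all measures on `X`. -/
def giryInclusion : giry.{u}.toFunctor ⟶ MeasCat.Giry.{u}.toFunctor where
  app _ := ⟨fun ν => ProbabilityMeasure.toMeasure ν, measurable_toMeasure⟩
  naturality _ _ _ := rfl

/-- The measure `δ_{x₁} + ⋯ + δ_{xₙ}` of a bag `[x₁, …, xₙ]`. -/
def bagMeasure {X : Type u} [MeasurableSpace X] (b : Multiset X) : Measure X :=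
  (b.map Measure.dirac).sum

lemma measurable_bagMeasure {X : Type u} [MeasurableSpace X] :
    Measurable (bagMeasure : Multiset X → Measure X) := by
  classical
  refine Measure.measurable_of_measurable_coe _ fun U hU => ?_
  have : (fun b : Multiset X => bagMeasure b U) = fun b => (b.countP (· ∈ U) : ℝ≥0∞) := by
    funext b
    induction b using Multiset.induction with
    | empty => simp [bagMeasure]
    | cons x b ih =>
      simp only [bagMeasure] at ih
      simp only [bagMeasure, Multiset.map_cons, Multiset.sum_cons, Measure.add_apply, ih,
        Multiset.countP_cons, Measure.dirac_apply' _ hU]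
      by_cases hx : x ∈ U <;> simp [hx, add_comm]
  rw [this]
  exact (measurable_from_top (f := fun k : ℕ => (k : ℝ≥0∞))).comp (measurable_countP hU)

/-- The transformation `i^B : B → M`. -/
def bagInclusion : bag.{u}.toFunctor ⟶ MeasCat.Giry.{u}.toFunctor where
  app X := ⟨bagMeasure, measurable_bagMeasure⟩
  naturality _ _ f := Subtype.ext <| funext fun b => by
    change bagMeasure (Multiset.map f.1 b) = Measure.map f.1 (bagMeasure b)
    induction b using Multiset.induction with
    | empty => simp [bagMeasure]
    | cons x b ih =>
      simp only [bagMeasure] at ih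
      simp only [bagMeasure, Multiset.map_cons, Multiset.sum_cons, ih,
        Measure.map_add _ _ f.2, Measure.map_dirac' f.2]

/-- The intensity `𝔼 = μ^M ∘ (i^G ∗ i^B) : GB → M`. -/
def intensity : pointProcess.{u}.toFunctor ⟶ MeasCat.Giry.{u}.toFunctor :=
  (show bag.toFunctor ⋙ giry.toFunctor ⟶ _ from bagInclusion ◫ giryInclusion) ≫ MeasCat.Giry.μ

/-- The measure `𝔼_X(α)` on `X` of a point process `α` on `X`. -/
def intensityMeasure {X : Type u} [MeasurableSpace X] (α : ProbabilityMeasure (Multiset X)) :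
    Measure X :=
  intensity.app (MeasCat.of X) α

end
end PointProcess

namespace PointProcess

/-! A measure is determined by its integrals against measurable `f : X → [0,∞]`, so every identity
is tested on such an `f`. Integrating `f` against the intensity of `α` gives the expectation under
`α` of the sum of `f` over the points of a bag (Campbell's formula, `lintegral_intensityMeasure`).

The unit law then says that the bag `[x]` has counting measure `δ_x`. For the multiplication law,
let `P` be a random bag of point processes. Merging independent samples from the processes `β` in a
bag `b` gives a random bag whose expected `f`-sum is, by linearity of expectation, the sum over `β ∈
b` of the expected `f`-sum under `β`. This is `lintegral_bagLaw`; only the marginals of the product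
measure matter. By Campbell's formula each summand is the integral of `f` against the intensity of
`β`, which is the integrand on the `MM` side. The two sides are therefore integrals over `P` of the
same function of `b` (`intensityMeasure_mul`).

Taking the indicator of `U` for `f` makes the intensity of `U` the mean of the number of points in
`U`, and summing over the values of this count gives the explicit formula. All quantities lie in
`[0,∞]`, so no summability or finiteness condition arises. -/

/-! ### Integration against the counting measure of a bag -/

lemma lintegral_bagMeasure {X : Type u} [MeasurableSpace X] {f : X → ℝ≥0∞} (hf : Measurable f)
    (b : Multiset X) : ∫⁻ x, f x ∂bagMeasure b = (b.map f).sum := by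
  induction b using Multiset.induction with
  | empty => simp [bagMeasure]
  | cons x b ih =>
    simp only [bagMeasure] at ih
    simp only [bagMeasure, Multiset.map_cons, Multiset.sum_cons, lintegral_add_measure,
      lintegral_dirac' x hf, ih]

/-- The sum is the composite of the measurable map `bagMeasure` with integration of `f`, so no
approximation by simple functions is needed. -/
lemma measurable_sum_map {X : Type u} [MeasurableSpace X] {f : X → ℝ≥0∞} (hf : Measurable f) :
    Measurable fun b : Multiset X => (b.map f).sum := by
  simp only [← lintegral_bagMeasure hf]
  exact (Measure.measurable_lintegral hf).comp measurable_bagMeasure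

lemma bagMeasure_apply {X : Type u} [MeasurableSpace X] {U : Set X} (hU : MeasurableSet U)
    (b : Multiset X) :
    bagMeasure b U = open Classical in (b.countP (· ∈ U) : ℝ≥0∞) := by
  classical
  rw [← lintegral_indicator_one hU, lintegral_bagMeasure (measurable_one.indicator hU)]
  induction b using Multiset.induction with
  | empty => simp
  | cons x b ih =>
    rw [Multiset.map_cons, Multiset.sum_cons, ih, Multiset.countP_cons]
    by_cases hx : x ∈ U <;> simp [hx, add_comm]

/-! ### The intensity as a monadic bind, and Campbell's formula -/

/-- Horizontal composition unfolds to including `α` among all measures, pushing it forward along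
`bagMeasure` and applying `join`, which is the definition of `bind`. -/
lemma intensityMeasure_eq {X : Type u} [MeasurableSpace X] (α : ProbabilityMeasure (Multiset X)) :
    intensityMeasure α = α.toMeasure.bind bagMeasure := rfl

lemma measurable_intensityMeasure {X : Type u} [MeasurableSpace X] :
    Measurable (intensityMeasure : ProbabilityMeasure (Multiset X) → Measure X) :=
  (Measure.measurable_bind' measurable_bagMeasure).comp measurable_toMeasure

/-- Campbell's formula. -/
lemma lintegral_intensityMeasure {X : Type u} [MeasurableSpace X]
    (α : ProbabilityMeasure (Multiset X)) {f : X → ℝ≥0∞} (hf : Measurable f) :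
    ∫⁻ x, f x ∂intensityMeasure α = ∫⁻ b, (b.map f).sum ∂α.toMeasure := by
  rw [intensityMeasure_eq, Measure.lintegral_bind measurable_bagMeasure.aemeasurable
    hf.aemeasurable]
  simp only [lintegral_bagMeasure hf]

lemma intensityMeasure_giryUnit {X : Type u} [MeasurableSpace X] (b : Multiset X) :
    intensityMeasure (giryUnit b) = bagMeasure b :=
  Measure.dirac_bind measurable_bagMeasure b

/-! ### Linearity of expectation and compatibility with the monad structures -/

/-- The expected sum of `f` over independent points is the sum of the expectations. -/
lemma lintegral_bagLaw {X : Type u} [MeasurableSpace X] {f : X → ℝ≥0∞} (hf : Measurable f)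
    (b : Multiset (ProbabilityMeasure X)) :
    ∫⁻ c, (c.map f).sum ∂(bagLaw b).toMeasure = (b.map fun ν => ∫⁻ x, f x ∂ν.toMeasure).sum := by
  have hs := measurable_sum_map hf
  induction b using Multiset.induction with
  | empty => rw [bagLaw_zero, lintegral_giryUnit hs]; simp
  | cons ν b ih =>
    -- With the first point fixed at `x`, its contribution `f x` is constant in `c`. It comes out
    -- with coefficient one because `bagLaw b` has total mass one.
    have hc : ∀ x, ∫⁻ c, (({x} + c : Multiset X).map f).sum ∂(bagLaw b).toMeasure =
        f x + ∫⁻ c, (c.map f).sum ∂(bagLaw b).toMeasure := fun x => by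
      simp only [Multiset.map_add, Multiset.sum_add, Multiset.map_singleton, Multiset.sum_singleton]
      rw [lintegral_add_left measurable_const]
      simp
    rw [bagLaw_cons, lintegral_conv hs, lintegral_push]
    · simp only [hc, ih]
      -- Here the contribution of the remaining points is the constant, and the total mass one of
      -- `ν` removes the factor.
      rw [lintegral_add_left hf]
      simp
    -- What remains is the side condition of `lintegral_push`: the inner integral of the convolution
    -- is measurable in its first argument.
    · exact Measurable.lintegral_prod_right'
        (f := fun z : Multiset X × Multiset X => ((z.1 + z.2).map f).sum)
        (hs.comp measurable_add)

/-- The intensity turns the multiplication of the point-process monad into that of measures. -/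
lemma intensityMeasure_mul {X : Type u} [MeasurableSpace X]
    (P : ProbabilityMeasure (Multiset (ProbabilityMeasure (Multiset X)))) :
    intensityMeasure (giryMul (push (fun b => push Multiset.join measurable_bagSum (bagLaw b))
        ((measurable_push measurable_bagSum).comp measurable_bagLaw) P)) =
      (intensityMeasure (push (Multiset.map intensityMeasure)
        (measurable_bagMap measurable_intensityMeasure) P)).join := by
  refine Measure.ext_of_lintegral _ fun f hf => ?_
  have hs := measurable_sum_map hf
  have hI := Measure.measurable_lintegral hf
  rw [lintegral_intensityMeasure _ hf, lintegral_giryMul _ hs,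
    lintegral_push (measurable_lintegral_toMeasure hs), Measure.lintegral_join hf.aemeasurable,
    lintegral_intensityMeasure _ hI, lintegral_push (measurable_sum_map hI)]
  -- Both sides are now integrals over `P`, so it suffices to compare integrands at a fixed bag `b`
  -- of point processes; no exchange of integrals is involved.
  refine lintegral_congr fun b => ?_
  rw [lintegral_push hs]
  simp only [Multiset.map_join, Multiset.sum_join, Multiset.map_map, Function.comp_def]
  -- The sum over the merged bag has become an iterated sum. Hence `lintegral_bagLaw` applies on the
  -- space of bags, to the function `c ↦ (c.map f).sum`, and Campbell's formula identifies each
  -- summand on the other side.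
  simp only [lintegral_bagLaw hs, lintegral_intensityMeasure _ hf]

/-- The intensity as a morphism of monads. -/
noncomputable def intensityHom : MonadHom pointProcess.{u} MeasCat.Giry.{u} where
  toNatTrans := intensity
  app_η X := Subtype.ext <| funext fun x => by
    change intensityMeasure (push (fun x => {x}) measurable_bagSingleton (giryUnit x)) =
      Measure.dirac x
    rw [push_giryUnit, intensityMeasure_giryUnit]
    simp [bagMeasure]
  app_μ X := by
    change bagGiryLaw.mul.app X ≫ _ = _
    -- This form of the multiplication merges bags before averaging with `μ^G`, which is the shape
    -- of the left side of `intensityMeasure_mul`.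
    rw [bagGiryLaw.mul_app']
    exact Subtype.ext <| funext fun P => intensityMeasure_mul P

/-! ### The explicit formula for the intensity -/

lemma intensityMeasure_apply {X : Type u} [MeasurableSpace X]
    (α : ProbabilityMeasure (Multiset X)) {U : Set X} (hU : MeasurableSet U) :
    intensityMeasure α U = ∑' k : ℕ, (k : ℝ≥0∞) * α.toMeasure (bagSet U k) := by
  classical
  rw [intensityMeasure_eq, Measure.bind_apply hU measurable_bagMeasure.aemeasurable]
  simp only [bagMeasure_apply hU]
  have hc := measurable_countP hU
  -- The mean of the count is computed from its law on `ℕ`, where the integral is a sum over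
  -- singletons. The preimage of `{k}` under the count is `bagSet U k` by definition.
  rw [← lintegral_map (f := fun k : ℕ => (k : ℝ≥0∞)) measurable_from_top hc, lintegral_countable']
  refine tsum_congr fun k => ?_
  rw [Measure.map_apply hc (measurableSet_singleton k)]
  rfl

end PointProcess

theorem mainTheorem2 :
    (∃ φ : MonadHom PointProcess.pointProcess.{u} MeasCat.Giry.{u},
      φ.toNatTrans = PointProcess.intensity.{u}) ∧
    ∀ (X : Type u) [MeasurableSpace X] (α : ProbabilityMeasure (Multiset X)) (U : Set X),
      MeasurableSet U →
        PointProcess.intensityMeasure α U =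
          ∑' k : ℕ, (k : ℝ≥0∞) * α.toMeasure (PointProcess.bagSet U k) :=
  ⟨⟨PointProcess.intensityHom, rfl⟩, fun _ _ α _ hU => PointProcess.intensityMeasure_apply α hU⟩
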